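/- Let $K$ be a CM field of degree $2g$ (a totally imaginary quadratic extension of a totally real number field) that contains no strict CM subfield, and let $\overline{\,\cdot\,}$ denote complex conjugation on $K$. A CM type of $K$ is a set $\Phi$ of $g$ embeddings $K\to\mathbf{C}$ such that $\Phi\cup\overline{\Phi}$ is the set of all embeddings; we also write $\Phi:K\to\mathbf{C}^g$ for the map $\alpha\mapsto(\phi(\alpha))_{\phi\in\Phi}$. Consider triples $(\Phi,\mathfrak{a},\xi)$ consisting of a CM type $\Phi$ of $K$, a nonzero fractional $\mathcal{O}_K$-ideal $\mathfrak{a}$, and an element $\xi\in K$ that generates the fractional ideal $(\mathfrak{a}\overline{\mathfrak{a}}\mathcal{D}_{K/\mathbf{Q}})^{-1}$, where $\mathcal{D}_{K/\mathbf{Q}}$ is the different of $K$, and such that $\phi(\xi)$ lies on the positive imaginary axis for every $\phi\in\Phi$. To such a triple one associates the principally polarized abelian variety $A_{\Phi,\mathfrak{a},\xi}=(\mathbf{C}^g/\Phi(\mathfrak{a}),E)$, where $E:\mathbf{C}^g\times\mathbf{C}^g\to\mathbf{R}$ is the unique $\mathbf{R}$-bilinear form with $E(\Phi(\alpha),\Phi(\beta))=\mathrm{Tr}_{K/\mathbf{Q}}(\xi\alpha\overline{\beta})$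 for all $\alpha,\beta\in K$. An isomorphism $(\mathbf{C}^g/\Lambda,E)\to(\mathbf{C}^g/\Lambda',E')$ is a $\mathbf{C}$-linear isomorphism $f:\mathbf{C}^g\to\mathbf{C}^g$ with $f(\Lambda)=\Lambda'$ and $E'(f(u),f(v))=E(u,v)$ for all $u,v\in\mathbf{C}^g$. Then for any two such triples $(\Phi,\mathfrak{a},\xi)$ and $(\Phi',\mathfrak{a}',\xi')$, the principally polarized abelian varieties $A_{\Phi,\mathfrak{a},\xi}$ and $A_{\Phi',\mathfrak{a}',\xi'}$ are isomorphic if and only if there exist $\sigma\in\mathrm{Aut}(K)$ and $\gamma\in K^*$ such that (a) $\Phi'=\Phi\circ\sigma=\{\phi\circ\sigma:\phi\in\Phi\}$, (b) $\sigma\mathfrak{a}'=\gamma\mathfrak{a}$, and (c) $\sigma\xi'=(\gamma\overline{\gamma})^{-1}\xi$. -/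

import Mathlib

open NumberField Module
open scoped nonZeroDivisors ComplexConjugate

/-! ## Complex tori with a principal polarization -/

/-- A principally polarized abelian variety `(ℂ^g / Λ, E)`, with `ℂ^g` written as `ι → ℂ`: a lattice `Λ` of full
rank together with an alternating `ℝ`-bilinear form `E` that is integral on `Λ`, satisfies
`E(iu, iv) = E(u, v)`, is positive in the sense that `E(u, iu) > 0` for `u ≠ 0`, and is principal:
`Λ` is its own dual under `E`, that is, `E` has determinant `1` in a `ℤ`-basis of `Λ`. -/
structure PrincipallyPolarizedAbelianVariety (ι : Type*) [Fintype ι] where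
  /-- The lattice `Λ ⊆ ℂ^g`. -/
  lattice : Submodule ℤ (ι → ℂ)
  discrete : DiscreteTopology lattice
  full_rank : Submodule.span ℝ (lattice : Set (ι → ℂ)) = ⊤
  /-- The polarization `E`. -/
  form : LinearMap.BilinForm ℝ (ι → ℂ)
  form_self : ∀ u, form u u = 0
  form_integral : ∀ u ∈ lattice, ∀ v ∈ lattice, ∃ n : ℤ, form u v = n
  form_I_smul : ∀ u v, form (Complex.I • u) (Complex.I • v) = form u v
  form_pos : ∀ u, u ≠ 0 → 0 < form u (Complex.I • u)
  form_principal : ∀ u, (∀ v ∈ lattice, ∃ n : ℤ, form u v = n) → u ∈ lattice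

/-- Two principally polarized abelian varieties are isomorphic if there is a `ℂ`-linear isomorphism `f` of the
ambient spaces with `f(Λ) = Λ'` and `f^* E' = E`. -/
def PrincipallyPolarizedAbelianVariety.Isomorphic {ι ι' : Type*} [Fintype ι] [Fintype ι']
    (A : PrincipallyPolarizedAbelianVariety ι) (A' : PrincipallyPolarizedAbelianVariety ι') : Prop :=
  ∃ f : (ι → ℂ) ≃ₗ[ℂ] (ι' → ℂ),
    f '' (A.lattice : Set (ι → ℂ)) = (A'.lattice : Set (ι' → ℂ)) ∧
    ∀ u v, A'.form (f u) (f v) = A.form u v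

/-! ## CM types -/

section CMType

variable {K : Type*} [Field K] [NumberField K]

/-- A CM type of a field `K` of degree `2g`: a set `Φ` of `g` embeddings `K → ℂ` such that
`Φ ∪ Φ̄` is the set of all embeddings. -/
@[ext]
structure CMType (K : Type*) [Field K] [NumberField K] where
  embeddings : Finset (K →+* ℂ)
  two_mul_card : 2 * embeddings.card = finrank ℚ K
  mem_or_conj_mem : ∀ ψ : K →+* ℂ,
    ψ ∈ embeddings ∨ ComplexEmbedding.conjugate ψ ∈ embeddings

namespace CMType

/-- The CM type `Φ ∘ σ = {φ ∘ σ : φ ∈ Φ}`, for an automorphism `σ` of `K`. -/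
def comp (Φ : CMType K) (σ : K ≃+* K) : CMType K where
  embeddings := Φ.embeddings.map
    ⟨fun φ => φ.comp (σ : K →+* K), fun φ ψ h => by
      ext x
      simpa using RingHom.congr_fun h (σ.symm x)⟩
  two_mul_card := by rw [Finset.card_map, Φ.two_mul_card]
  mem_or_conj_mem ψ := by
    have key : ∀ χ : K →+* ℂ, (χ.comp (σ.symm : K →+* K)).comp (σ : K →+* K) = χ := by
      intro χ; ext x; simp
    simp only [Finset.mem_map]
    refine (Φ.mem_or_conj_mem (ψ.comp (σ.symm : K →+* K))).imp
      (fun h => ⟨_, h, key ψ⟩) (fun h => ⟨_, h, ?_⟩)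
    exact key (ComplexEmbedding.conjugate ψ)

/-- The map `Φ : K → ℂ^g`, `α ↦ (φ(α))_{φ ∈ Φ}`, where `ℂ^g` has its coordinates indexed by `Φ`. -/
def toPi (Φ : CMType K) : K →+* (Φ.embeddings → ℂ) :=
  RingHom.pi fun φ => (φ : K →+* ℂ)

@[simp]
theorem toPi_apply (Φ : CMType K) (α : K) (φ : Φ.embeddings) :
    Φ.toPi α φ = (φ : K →+* ℂ) α := rfl

theorem sum_embeddings (Φ : CMType K) (F : (K →+* ℂ) → ℂ) :
    ∑ ψ, F ψ = ∑ φ : Φ.embeddings, (F φ + F (ComplexEmbedding.conjugate (φ : K →+* ℂ))) := by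
  classical
  have hinv : ∀ ψ : K →+* ℂ,
      ComplexEmbedding.conjugate (ComplexEmbedding.conjugate ψ) = ψ := star_star
  let c : (K →+* ℂ) ↪ (K →+* ℂ) :=
    ⟨ComplexEmbedding.conjugate, fun a b h => by rw [← hinv a, ← hinv b, h]⟩
  have hu : Φ.embeddings ∪ Φ.embeddings.map c = Finset.univ := by
    ext ψ
    simp only [Finset.mem_union, Finset.mem_map, Finset.mem_univ, iff_true]
    exact (Φ.mem_or_conj_mem ψ).imp id fun h => ⟨_, h, hinv ψ⟩
  have hd : Disjoint Φ.embeddings (Φ.embeddings.map c) := by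
    rw [← Finset.card_union_eq_card_add_card, hu, Finset.card_map, Finset.card_univ,
      Embeddings.card, ← Φ.two_mul_card, two_mul]
  rw [← hu, Finset.sum_union hd, Finset.sum_map, ← Finset.sum_add_distrib,
    ← Finset.sum_coe_sort Φ.embeddings]
  rfl

/-- The `ℝ`-bilinear form `E(z, w) = ∑_{φ ∈ Φ} 2 Re(φ(ξ) z_φ conj(w_φ))` on `ℂ^g`. By
`CMType.form_toPi` and `CMType.eq_form`, for a CM field it is the unique `ℝ`-bilinear form with
`E(Φ(α), Φ(β)) = Tr_{K/ℚ}(ξ α β̄)` for all `α, β ∈ K`. -/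
noncomputable def form (Φ : CMType K) (ξ : K) : LinearMap.BilinForm ℝ (Φ.embeddings → ℂ) :=
  LinearMap.mk₂ ℝ
    (fun z w => ∑ φ : Φ.embeddings, 2 * ((φ : K →+* ℂ) ξ * z φ * conj (w φ)).re)
    (by intro z z' w
        rw [← Finset.sum_add_distrib]
        refine Finset.sum_congr rfl fun φ _ => ?_
        simp only [Pi.add_apply, mul_add, add_mul, Complex.add_re])
    (by intro c z w
        rw [smul_eq_mul, Finset.mul_sum]
        refine Finset.sum_congr rfl fun φ _ => ?_
        simp
        ring)
    (by intro z w w'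
        rw [← Finset.sum_add_distrib]
        refine Finset.sum_congr rfl fun φ _ => ?_
        simp only [Pi.add_apply, map_add, mul_add, Complex.add_re])
    (by intro c z w
        rw [smul_eq_mul, Finset.mul_sum]
        refine Finset.sum_congr rfl fun φ _ => ?_
        simp
        ring)

theorem form_apply (Φ : CMType K) (ξ : K) (z w : Φ.embeddings → ℂ) :
    Φ.form ξ z w = ∑ φ : Φ.embeddings, 2 * ((φ : K →+* ℂ) ξ * z φ * conj (w φ)).re := rfl

theorem form_toPi [IsCMField K] (Φ : CMType K) (ξ α β : K) :
    Φ.form ξ (Φ.toPi α) (Φ.toPi β) =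
      (Algebra.trace ℚ K (ξ * α * IsCMField.complexConj K β) : ℚ) := by
  have h := trace_eq_sum_embeddings (K := ℚ) (L := K) ℂ
    (x := ξ * α * IsCMField.complexConj K β)
  have h2 : ∑ σ : K →ₐ[ℚ] ℂ, σ (ξ * α * IsCMField.complexConj K β) =
      ∑ ψ : K →+* ℂ, ψ (ξ * α * IsCMField.complexConj K β) :=
    (Fintype.sum_equiv (RingHom.equivRatAlgHom K ℂ) _ _ fun _ => rfl).symm
  rw [h2, Φ.sum_embeddings] at h
  apply Complex.ofReal_injective
  rw [form_apply, Complex.ofReal_sum, Complex.ofReal_ratCast]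
  refine Eq.trans (Finset.sum_congr rfl fun φ _ => ?_) h.symm
  rw [ComplexEmbedding.conjugate_coe_eq, Complex.add_conj]
  simp

theorem linearIndependent_toPi [IsCMField K] (Φ : CMType K)
    (I : (FractionalIdeal (𝓞 K)⁰ K)ˣ) :
    LinearIndependent ℝ (fun i => Φ.toPi (basisOfFractionalIdeal K I i)) := by
  rw [Fintype.linearIndependent_iff]
  intro r hr
  have hli := (mixedEmbedding.fractionalIdealLatticeBasis K I).linearIndependent
  rw [Fintype.linearIndependent_iff] at hli
  refine hli r ?_
  have hφ : ∀ φ ∈ Φ.embeddings, ∑ i, (r i : ℂ) * φ (basisOfFractionalIdeal K I i) = 0 := by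
    intro φ hφ
    simpa [Finset.sum_apply] using congrFun hr ⟨φ, hφ⟩
  have hall : ∀ ψ : K →+* ℂ, ∑ i, (r i : ℂ) * ψ (basisOfFractionalIdeal K I i) = 0 := by
    intro ψ
    rcases Φ.mem_or_conj_mem ψ with h | h
    · exact hφ ψ h
    · have := congrArg conj (hφ _ h)
      simpa [map_sum] using this
  simp only [mixedEmbedding.fractionalIdealLatticeBasis_apply]
  refine Prod.ext (funext fun w => ?_) (funext fun w => ?_)
  · exact absurd w.2 (InfinitePlace.not_isReal_iff_isComplex.mpr
      (IsTotallyComplex.isComplex w.1))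
  · simpa [Prod.snd_sum, Finset.sum_apply] using hall w.1.embedding

/-- The images under `Φ` of a `ℤ`-basis of a fractional ideal form an `ℝ`-basis of `ℂ^g`. -/
noncomputable def latticeBasis [IsCMField K] (Φ : CMType K) (I : (FractionalIdeal (𝓞 K)⁰ K)ˣ) :
    Basis (Free.ChooseBasisIndex ℤ I) ℝ (Φ.embeddings → ℂ) :=
  @basisOfLinearIndependentOfCardEqFinrank' ℝ (Φ.embeddings → ℂ) _ _ _ _ _ _
    _ (Φ.linearIndependent_toPi I) (by
      rw [← finrank_eq_card_basis (basisOfFractionalIdeal K I), ← Φ.two_mul_card,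
        finrank_pi_fintype]
      simp [mul_comm])

theorem coe_latticeBasis [IsCMField K] (Φ : CMType K) (I : (FractionalIdeal (𝓞 K)⁰ K)ˣ) :
    (Φ.latticeBasis I : _ → Φ.embeddings → ℂ) =
      fun i => Φ.toPi (basisOfFractionalIdeal K I i) := by
  rw [latticeBasis, coe_basisOfLinearIndependentOfCardEqFinrank']

/-- The form `CMType.form` is the only `ℝ`-bilinear extension of `(α, β) ↦ Tr_{K/ℚ}(ξ α β̄)`. -/
theorem eq_form [IsCMField K] (Φ : CMType K) (ξ : K)
    (B : LinearMap.BilinForm ℝ (Φ.embeddings → ℂ))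
    (hB : ∀ α β : K, B (Φ.toPi α) (Φ.toPi β) =
      (Algebra.trace ℚ K (ξ * α * IsCMField.complexConj K β) : ℚ)) :
    B = Φ.form ξ :=
  LinearMap.BilinForm.ext_basis (Φ.latticeBasis 1) fun i j => by
    rw [coe_latticeBasis, hB, form_toPi]

/-- The subgroup `Φ(𝔞)` of `ℂ^g`, for a fractional ideal `𝔞`. -/
noncomputable def lattice (Φ : CMType K) (𝔞 : FractionalIdeal (𝓞 K)⁰ K) :
    Submodule ℤ (Φ.embeddings → ℂ) :=
  ((𝔞 : Submodule (𝓞 K) K).restrictScalars ℤ).map Φ.toPi.toAddMonoidHom.toIntLinearMap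

theorem mem_lattice (Φ : CMType K) (𝔞 : FractionalIdeal (𝓞 K)⁰ K) (u : Φ.embeddings → ℂ) :
    u ∈ Φ.lattice 𝔞 ↔ ∃ α ∈ 𝔞, Φ.toPi α = u := Iff.rfl

theorem lattice_eq_span [IsCMField K] (Φ : CMType K) (I : (FractionalIdeal (𝓞 K)⁰ K)ˣ) :
    Φ.lattice I = Submodule.span ℤ (Set.range (Φ.latticeBasis I)) := by
  have h : ((I : FractionalIdeal (𝓞 K)⁰ K) : Submodule (𝓞 K) K).restrictScalars ℤ =
      Submodule.span ℤ (Set.range (basisOfFractionalIdeal K I)) :=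
    Submodule.ext fun x => (mem_span_basisOfFractionalIdeal K).symm
  rw [lattice, h, Submodule.map_span, ← Set.range_comp, coe_latticeBasis]
  rfl

end CMType

/-! ## The principally polarized abelian varieties attached to triples -/

/-- The image `σ(𝔞)` of a fractional ideal under a field automorphism. -/
def fractionalIdealImage (σ : K ≃+* K) (𝔞 : FractionalIdeal (𝓞 K)⁰ K) :
    FractionalIdeal (𝓞 K)⁰ K :=
  ⟨{ carrier := σ '' (𝔞 : Set K)
     add_mem' := by
       rintro _ _ ⟨a, ha, rfl⟩ ⟨b, hb, rfl⟩
       exact ⟨a + b, (𝔞 : Submodule (𝓞 K) K).add_mem ha hb, map_add σ a b⟩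
     zero_mem' := ⟨0, (𝔞 : Submodule (𝓞 K) K).zero_mem, map_zero σ⟩
     smul_mem' := by
       rintro c _ ⟨a, ha, rfl⟩
       refine ⟨(RingOfIntegers.mapRingEquiv σ).symm c • a,
         (𝔞 : Submodule (𝓞 K) K).smul_mem _ ha, ?_⟩
       simp [Algebra.smul_def] }, by
    obtain ⟨d, hd, h⟩ := 𝔞.isFractional
    refine ⟨RingOfIntegers.mapRingEquiv σ d, ?_, ?_⟩
    · rw [mem_nonZeroDivisors_iff_ne_zero] at hd ⊢
      simpa using hd
    · rintro _ ⟨a, ha, rfl⟩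
      obtain ⟨c, hc⟩ := h a ha
      refine ⟨RingOfIntegers.mapRingEquiv σ c, ?_⟩
      have := congrArg σ hc
      simpa [Algebra.smul_def] using this⟩

theorem mem_fractionalIdealImage (σ : K ≃+* K) (𝔞 : FractionalIdeal (𝓞 K)⁰ K) (x : K) :
    x ∈ fractionalIdealImage σ 𝔞 ↔ ∃ a ∈ 𝔞, σ a = x := Iff.rfl

/-- A triple `(Φ, 𝔞, ξ)`: a CM type `Φ` of `K`, a (nonzero) fractional `𝓞 K`-ideal `𝔞`, and a
generator `ξ` of `(𝔞 𝔞̄ 𝓓_{K/ℚ})⁻¹` such that `φ(ξ)` lies on the positive imaginary axis for all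
`φ ∈ Φ`. -/
structure CMTriple (K : Type*) [Field K] [NumberField K] [IsCMField K] where
  Φ : CMType K
  𝔞 : FractionalIdeal (𝓞 K)⁰ K
  ξ : K
  ideal_ne_zero : 𝔞 ≠ 0
  span_eq : FractionalIdeal.spanSingleton (𝓞 K)⁰ ξ =
    (𝔞 * fractionalIdealImage (IsCMField.complexConj K : K ≃+* K) 𝔞 *
      (differentIdeal ℤ (𝓞 K) : FractionalIdeal (𝓞 K)⁰ K))⁻¹
  pos_imaginary : ∀ φ ∈ Φ.embeddings, (φ ξ).re = 0 ∧ 0 < (φ ξ).im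

namespace CMTriple

variable [IsCMField K]

/-- The complex conjugate `𝔞̄` of the ideal of a triple. -/
noncomputable abbrev conjIdeal (T : CMTriple K) : FractionalIdeal (𝓞 K)⁰ K :=
  fractionalIdealImage (IsCMField.complexConj K : K ≃+* K) T.𝔞

theorem conj_mem (T : CMTriple K) {β : K} (hβ : β ∈ T.𝔞) :
    IsCMField.complexConj K β ∈ T.conjIdeal := ⟨β, hβ, rfl⟩

theorem conjIdeal_ne_zero (T : CMTriple K) : T.conjIdeal ≠ 0 := by
  intro h
  apply T.ideal_ne_zero
  refine FractionalIdeal.eq_zero_iff.mpr fun x hx => ?_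
  have hx' := T.conj_mem hx
  rw [h, FractionalIdeal.mem_zero_iff] at hx'
  simpa using hx'

/-- `ξ𝔞` is the dual of `𝔞̄` under the trace form. -/
theorem span_mul_ideal (T : CMTriple K) :
    FractionalIdeal.spanSingleton (𝓞 K)⁰ T.ξ * T.𝔞 =
      FractionalIdeal.dual ℤ ℚ T.conjIdeal := by
  rw [T.span_eq, FractionalIdeal.dual_eq_mul_inv, mul_inv, mul_inv,
    coeIdeal_differentIdeal ℤ ℚ K (𝓞 K), inv_inv]
  calc _ = T.𝔞⁻¹ * T.𝔞 * (FractionalIdeal.dual ℤ ℚ 1 * T.conjIdeal⁻¹) := by ring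
    _ = _ := by rw [inv_mul_cancel₀ T.ideal_ne_zero, one_mul]

theorem trace_integral (T : CMTriple K) {α β : K} (hα : α ∈ T.𝔞) (hβ : β ∈ T.𝔞) :
    ∃ n : ℤ, Algebra.trace ℚ K (T.ξ * α * IsCMField.complexConj K β) = n := by
  have hβ' := T.conj_mem hβ
  have hmem : T.ξ * (α * IsCMField.complexConj K β) ∈
      FractionalIdeal.spanSingleton (𝓞 K)⁰ T.ξ * (T.𝔞 * T.conjIdeal) :=
    FractionalIdeal.mul_mem_mul (FractionalIdeal.mem_spanSingleton_self _ _)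
      (FractionalIdeal.mul_mem_mul hα hβ')
  rw [← mul_assoc, T.span_mul_ideal, FractionalIdeal.dual_mul_self ℤ ℚ T.conjIdeal_ne_zero,
    FractionalIdeal.mem_dual (one_ne_zero' (FractionalIdeal (𝓞 K)⁰ K))] at hmem
  obtain ⟨n, hn⟩ := hmem 1 (FractionalIdeal.one_mem_one _)
  refine ⟨n, ?_⟩
  rw [Algebra.traceForm_apply, mul_one, ← mul_assoc] at hn
  rw [← hn]
  simp

theorem lattice_eq_span (T : CMTriple K) :
    T.Φ.lattice T.𝔞 = Submodule.span ℤ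
      (Set.range (T.Φ.latticeBasis (Units.mk0 T.𝔞 T.ideal_ne_zero))) :=
  T.Φ.lattice_eq_span (Units.mk0 T.𝔞 T.ideal_ne_zero)

theorem form_pos (T : CMTriple K) (u : T.Φ.embeddings → ℂ) (hu : u ≠ 0) :
    0 < T.Φ.form T.ξ u (Complex.I • u) := by
  rw [CMType.form_apply]
  have hterm : ∀ φ : T.Φ.embeddings,
      2 * ((φ : K →+* ℂ) T.ξ * u φ * conj ((Complex.I • u) φ)).re =
        2 * ((φ : K →+* ℂ) T.ξ).im * Complex.normSq (u φ) := by
    intro φ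
    have : (φ : K →+* ℂ) T.ξ * u φ * conj ((Complex.I • u) φ) =
        (φ : K →+* ℂ) T.ξ * -Complex.I * (Complex.normSq (u φ) : ℂ) := by
      rw [← Complex.mul_conj]
      simp only [Pi.smul_apply, smul_eq_mul, map_mul, Complex.conj_I]
      ring
    rw [this, Complex.re_mul_ofReal]
    simp
    ring
  obtain ⟨φ, hφ⟩ := Function.ne_iff.mp hu
  simp only [hterm]
  refine Finset.sum_pos' (fun ψ _ => ?_) ⟨φ, Finset.mem_univ _, ?_⟩
  · have := (T.pos_imaginary ψ ψ.2).2
    have := Complex.normSq_nonneg (u ψ)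
    positivity
  · have := (T.pos_imaginary φ φ.2).2
    have : 0 < Complex.normSq (u φ) := Complex.normSq_pos.mpr hφ
    positivity

theorem mem_lattice_of_form_integral (T : CMTriple K) (u : T.Φ.embeddings → ℂ)
    (hu : ∀ v ∈ T.Φ.lattice T.𝔞, ∃ n : ℤ, T.Φ.form T.ξ u v = n) : u ∈ T.Φ.lattice T.𝔞 := by
  classical
  set I := Units.mk0 T.𝔞 T.ideal_ne_zero
  set b := basisOfFractionalIdeal K I
  set c := T.Φ.latticeBasis I
  have hc : ∀ i, c i = T.Φ.toPi (b i) := fun i => congrFun (T.Φ.coe_latticeBasis I) i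
  have hbc : ∀ i, c i ∈ T.Φ.lattice T.𝔞 := fun i => by
    rw [T.lattice_eq_span]; exact Submodule.subset_span ⟨i, rfl⟩
  choose n hn using fun i => hu (c i) (hbc i)
  let b' : Basis _ ℚ K := b.map
    ((IsCMField.complexConj K).toLinearEquiv.restrictScalars ℚ)
  have hb' : ∀ i, b' i = IsCMField.complexConj K (b i) := fun i => by simp [b']
  have hnd := traceForm_nondegenerate ℚ K
  let z : K := ∑ i, (n i : ℚ) • (Algebra.traceForm ℚ K).dualBasis hnd b' i
  have hz : ∀ i, Algebra.trace ℚ K (z * IsCMField.complexConj K (b i)) = n i := by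
    intro i
    rw [← hb', ← Algebra.traceForm_apply, map_sum, LinearMap.sum_apply]
    simp [LinearMap.BilinForm.apply_dualBasis_left]
  have hzd : z ∈ FractionalIdeal.dual ℤ ℚ T.conjIdeal := by
    rw [FractionalIdeal.mem_dual T.conjIdeal_ne_zero]
    rintro _ ⟨a, ha, rfl⟩
    have ha' : a ∈ Submodule.span ℤ (Set.range b) :=
      (mem_span_basisOfFractionalIdeal K).mpr ha
    clear ha
    rw [Algebra.traceForm_apply]
    induction ha' using Submodule.span_induction with
    | mem x hx =>
      obtain ⟨i, rfl⟩ := hx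
      exact ⟨n i, (hz i).symm⟩
    | zero => exact ⟨0, by simp⟩
    | add x y _ _ hx hy =>
      rw [map_add, mul_add, map_add]
      exact add_mem hx hy
    | smul r x _ hx =>
      rw [map_zsmul, mul_smul_comm, map_zsmul]
      exact zsmul_mem hx r
  rw [← T.span_mul_ideal, FractionalIdeal.mem_singleton_mul] at hzd
  obtain ⟨y, hy, hzy⟩ := hzd
  refine ⟨y, hy, ?_⟩
  by_contra hne
  have hzero : T.Φ.form T.ξ (u - T.Φ.toPi y) = 0 := by
    refine c.ext fun i => ?_
    rw [map_sub, LinearMap.sub_apply, hn, hc, T.Φ.form_toPi, ← hzy, hz]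
    simp
  have := T.form_pos (u - T.Φ.toPi y) (sub_ne_zero.mpr (Ne.symm hne))
  rw [hzero] at this
  simp at this

/-- The principally polarized abelian variety `A_{Φ,𝔞,ξ} = (ℂ^g / Φ(𝔞), E)`, where `E` is the `ℝ`-bilinear
form with `E(Φ(α), Φ(β)) = Tr_{K/ℚ}(ξ α β̄)`. -/
noncomputable def abelianVariety (T : CMTriple K) : PrincipallyPolarizedAbelianVariety T.Φ.embeddings where
  lattice := T.Φ.lattice T.𝔞
  discrete := by
    rw [T.lattice_eq_span]
    infer_instance
  full_rank := by
    rw [T.lattice_eq_span, eq_top_iff, ← (T.Φ.latticeBasis _).span_eq]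
    exact Submodule.span_mono Submodule.subset_span
  form := T.Φ.form T.ξ
  form_self u := by
    rw [CMType.form_apply]
    refine Finset.sum_eq_zero fun φ _ => ?_
    rw [mul_assoc, Complex.mul_conj, Complex.re_mul_ofReal, (T.pos_imaginary φ φ.2).1]
    simp
  form_integral := by
    rintro _ ⟨α, hα, rfl⟩ _ ⟨β, hβ, rfl⟩
    obtain ⟨n, hn⟩ := T.trace_integral hα hβ
    refine ⟨n, (T.Φ.form_toPi T.ξ α β).trans ?_⟩
    rw [hn, Rat.cast_intCast]
  form_I_smul u v := by
    rw [CMType.form_apply, CMType.form_apply]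
    refine Finset.sum_congr rfl fun φ _ => ?_
    congr 2
    simp only [Pi.smul_apply, smul_eq_mul, map_mul, Complex.conj_I]
    linear_combination (-(φ : K →+* ℂ) T.ξ * u φ * conj (v φ)) * Complex.I_mul_I
  form_pos := T.form_pos
  form_principal := T.mem_lattice_of_form_integral

end CMTriple

end CMType

/-! ## Automorphisms of `ℂ` -/

/-! Conditions (a)-(c) give an isomorphism directly: multiply coordinatewise by the values of `γ`
and reindex along `σ`.

Conversely, `f` maps `Φ(K)` into `Φ'(K)`, so `f ∘ Φ = Φ' ∘ h` for some `h : K → K`. Each `ψ' ∘ h` is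
a combination `∑ t ψ' ψ * ψ` of embeddings, involving only members of `Φ` if `ψ' ∈ Φ'` and only
non-members otherwise (`exists_coeff_of_linearMap`). Linear independence of embeddings makes `t`
unique, hence equivariant under `Aut(ℂ)`. Two embeddings occurring in the same `ψ' ∘ h` are
therefore never separated by `Φ`, even after applying an automorphism of `ℂ`; by primitivity
(`Inseparable.eq`) they coincide. So `ψ' ∘ h` is a multiple of one embedding and `h / h 1` is an
automorphism of `K`, with inverse `σ`. Lattices and forms then give (b) and (c).

Primitivity is where the absence of strict CM subfields enters. If the inseparability class of an
embedding had more than one element, the subfield on which the class agrees would be proper, hence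
fixed by complex conjugation. Sums over the class take values in the image of that subfield, so they
are real and the class is closed under conjugation; but `Φ` separates conjugates. -/

/-- An automorphism of a subfield extends to an automorphism of an algebraically closed field. -/
theorem IsAlgClosed.exists_ringEquiv_extending {M Ω : Type*} [Field M] [Field Ω] [IsAlgClosed Ω]
    [Algebra M Ω] (s : M ≃+* M) :
    ∃ S : Ω ≃+* Ω, ∀ m, S (algebraMap M Ω m) = algebraMap M Ω (s m) := by
  obtain ⟨ι, v, hv⟩ := exists_isTranscendenceBasis' M Ω
  have := IsAlgClosed.isAlgClosure_of_transcendence_basis v hv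
  -- `s` acts on coefficients and fixes the transcendence basis; `Ω` is an algebraic closure of this
  -- polynomial ring, so `e` extends.
  let e : Algebra.adjoin M (Set.range v) ≃+* Algebra.adjoin M (Set.range v) :=
    (hv.1.aevalEquiv.symm.toRingEquiv.trans (MvPolynomial.mapEquiv ι s)).trans
      hv.1.aevalEquiv.toRingEquiv
  refine ⟨IsAlgClosure.equivOfEquiv Ω Ω e, fun m => ?_⟩
  have h := IsAlgClosure.equivOfEquiv_algebraMap Ω Ω e
    (algebraMap M (Algebra.adjoin M (Set.range v)) m)
  have he : e (algebraMap M (Algebra.adjoin M (Set.range v)) m) =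
      algebraMap M (Algebra.adjoin M (Set.range v)) (s m) := by
    change hv.1.aevalEquiv (MvPolynomial.map (s : M →+* M) (hv.1.aevalEquiv.symm _)) = _
    rw [AlgEquiv.commutes, MvPolynomial.algebraMap_eq, MvPolynomial.map_C,
      ← MvPolynomial.algebraMap_eq, AlgEquiv.commutes]
    rfl
  rw [he] at h
  exact h

/-- An algebraic element fixed by all automorphisms over the base field lies in the base field. -/
theorem IsAlgClosed.mem_range_algebraMap_of_forall_fixed {F Ω : Type*} [Field F] [CharZero F]
    [Field Ω] [IsAlgClosed Ω] [Algebra F Ω] {z : Ω} (hz : IsAlgebraic F z)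
    (h : ∀ S : Ω ≃+* Ω, (∀ x, S (algebraMap F Ω x) = algebraMap F Ω x) → S z = z) :
    z ∈ Set.range (algebraMap F Ω) := by
  -- In characteristic zero `M` is Galois over `F`, and each element of its Galois group extends to
  -- `Ω`.
  let M := algebraicClosure F Ω
  have hM : IsGalois F M := { }
  have key : (⟨z, mem_algebraicClosure_iff.mpr hz⟩ : M) ∈ (⊥ : IntermediateField F M) := by
    rw [InfiniteGalois.mem_bot_iff_fixed]
    intro f
    obtain ⟨S, hS⟩ := IsAlgClosed.exists_ringEquiv_extending (Ω := Ω) f.toRingEquiv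
    have h1 := h S fun x => by
      rw [IsScalarTower.algebraMap_apply F M Ω, hS]
      exact congrArg _ (f.commutes x)
    apply Subtype.ext
    exact (hS ⟨z, mem_algebraicClosure_iff.mpr hz⟩).symm.trans h1
  obtain ⟨x, hx⟩ := IntermediateField.mem_bot.mp key
  exact ⟨x, congrArg Subtype.val hx⟩

/-- Any two embeddings of an algebraic extension differ by an automorphism. -/
theorem IsAlgClosed.exists_ringEquiv_comp_eq {F K Ω : Type*} [Field F] [CharZero F] [Field K]
    [Algebra F K] [Algebra.IsAlgebraic F K] [Field Ω] [IsAlgClosed Ω] [Algebra F Ω]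
    (φ ψ : K →ₐ[F] Ω) : ∃ S : Ω ≃+* Ω, ∀ x, S (φ x) = ψ x := by
  let M := algebraicClosure F Ω
  have hM : IsGalois F M := { }
  have lift : ∀ χ : K →ₐ[F] Ω, ∃ χ' : K →ₐ[F] M, ∀ x, (χ' x : Ω) = χ x := fun χ =>
    ⟨χ.codRestrict M.toSubalgebra fun x => mem_algebraicClosure_iff.mpr
      (IsAlgebraic.algHom χ (Algebra.IsAlgebraic.isAlgebraic x)), fun x => rfl⟩
  obtain ⟨φ', hφ⟩ := lift φ
  obtain ⟨ψ', hψ⟩ := lift ψ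
  -- With `K` embedded in `M` through `φ'`, normality extends `ψ'` to an endomorphism of `M`.
  let := φ'.toRingHom.toAlgebra
  have : IsScalarTower F K M := .of_algebraMap_eq fun q => (φ'.commutes q).symm
  let s : M →ₐ[F] M := AlgHom.liftNormal (K₁ := K) (K₂ := M) ψ' M
  have hs : ∀ x, s (φ' x) = ψ' x := fun x =>
    AlgHom.liftNormal_commutes (K₁ := K) (K₂ := M) ψ' M x
  obtain ⟨S, hS⟩ := IsAlgClosed.exists_ringEquiv_extending (Ω := Ω)
    (AlgEquiv.ofBijective s (AlgHom.normal_bijective F M M s)).toRingEquiv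
  refine ⟨S, fun x => ?_⟩
  have := hS (φ' x)
  change S (φ' x : Ω) = ((s (φ' x) : M) : Ω) at this
  rw [hs, hφ, hψ] at this
  exact this

/-- Distinct embeddings are linearly independent: equal combinations have equal coefficients. -/
theorem RingHom.eq_of_sum_mul_eq {K Ω : Type*} [Ring K] [CommRing Ω] [IsDomain Ω]
    [Fintype (K →+* Ω)] {s t : (K →+* Ω) → Ω}
    (h : ∀ x, ∑ ψ, s ψ * ψ x = ∑ ψ, t ψ * ψ x) : s = t := by
  have hli := (linearIndependent_monoidHom K Ω).comp
    (fun ψ : K →+* Ω => (ψ : K →* Ω)) RingHom.coe_monoidHom_injective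
  rw [Fintype.linearIndependent_iff] at hli
  funext ψ
  refine sub_eq_zero.mp (hli (s - t) (funext fun x => ?_) ψ)
  simpa [sub_mul, Finset.sum_apply, sub_eq_zero] using h x

/-! ## CM subfields and primitive CM types -/

/-- A subfield of a CM field that is stable under complex conjugation, and on which complex
conjugation is nontrivial, is a CM field. -/
theorem NumberField.IsCMField.of_complexConj_mem {K : Type*} [Field K] [NumberField K]
    [IsCMField K] (F : Subfield K) (hF : ∀ x ∈ F, IsCMField.complexConj K x ∈ F)
    {u : K} (huF : u ∈ F) (hu : IsCMField.complexConj K u ≠ u) : IsCMField F := by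
  have hlift : ∀ (φ : F →+* ℂ) (x : F), ComplexEmbedding.lift K φ x = φ x := fun φ x =>
    ComplexEmbedding.lift_algebraMap_apply K φ x
  have hreal : ∀ (φ : F →+* ℂ) (x : F),
      star (φ x) = φ x ↔ IsCMField.complexConj K (x : K) = x := by
    intro φ x
    rw [← hlift, ← (ComplexEmbedding.lift K φ).injective.eq_iff,
      IsCMField.complexEmbedding_complexConj]
    rfl
  -- Testing one embedding suffices, since the condition on the right does not involve `φ`.
  have hmem : ∀ x : F, x ∈ maximalRealSubfield F ↔ IsCMField.complexConj K (x : K) = x := by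
    intro x
    obtain ⟨φ⟩ : Nonempty (F →+* ℂ) := inferInstance
    exact ⟨fun h => (hreal φ x).mp (h φ), fun h φ => (hreal φ x).mpr h⟩
  have hc : IsTotallyComplex F := by
    refine ⟨fun v => ?_⟩
    rw [← InfinitePlace.not_isReal_iff_isComplex, InfinitePlace.isReal_iff]
    intro h
    refine hu ((hreal v.embedding ⟨u, huF⟩).mp ?_)
    exact RingHom.congr_fun (ComplexEmbedding.isReal_iff.mp h) ⟨u, huF⟩
  -- Conjugation negates `δ`, so `x = (x + x̄)/2 + ((x - x̄)/(2δ)) δ` shows that `1, δ` span `F`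
  -- over its real subfield.
  let δ : F := ⟨u - IsCMField.complexConj K u, F.sub_mem huF (hF u huF)⟩
  have hδ : IsCMField.complexConj K (δ : K) = -δ := by simp [δ]
  have hδ0 : δ ≠ 0 := fun h => hu (sub_eq_zero.mp (congrArg Subtype.val h)).symm
  have hδ1 : (δ : K) ≠ 0 := fun h => hδ0 (Subtype.ext h)
  have hδr : δ ∉ maximalRealSubfield F := by
    rw [hmem, hδ, neg_eq_self]
    exact hδ1
  have hli : LinearIndependent (maximalRealSubfield F) ![(1 : F), δ] := by
    rw [LinearIndependent.pair_iff]
    intro s t hst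
    have ht : t = 0 := by
      by_contra ht
      apply hδr
      have : δ = ((-s / t : maximalRealSubfield F) : F) := by
        have ht' : (t : F) ≠ 0 := fun h => ht (Subtype.ext h)
        simp only [Subfield.smul_def, smul_eq_mul, mul_one] at hst
        push_cast
        rw [eq_div_iff ht']
        linear_combination hst
      rw [this]
      exact SetLike.coe_mem _
    subst ht
    simpa [Subfield.smul_def] using hst
  have hsp : ⊤ ≤ Submodule.span (maximalRealSubfield F) (Set.range ![(1 : F), δ]) := by
    intro x _
    have h2 : ((2 : F) : K) = 2 := rfl
    have hc2 : IsCMField.complexConj K (2 : K) = 2 := map_ofNat _ 2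
    let y : F := ⟨IsCMField.complexConj K x, hF x x.2⟩
    have hy : ((x + y) / 2 : F) ∈ maximalRealSubfield F := by
      rw [hmem]; simp [y, h2, hc2, add_comm]
    have hz : ((x - y) / (2 * δ) : F) ∈ maximalRealSubfield F := by
      rw [hmem]
      push_cast
      rw [map_div₀, map_sub, map_mul, hδ]
      simp only [y, h2, hc2, IsCMField.complexConj_apply_apply]
      field_simp
      ring
    rw [Matrix.range_cons, Matrix.range_cons, Matrix.range_empty, Set.union_empty,
      Set.singleton_union, Submodule.mem_span_pair]
    refine ⟨⟨_, hy⟩, ⟨_, hz⟩, ?_⟩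
    simp only [Subfield.smul_def, smul_eq_mul]
    field_simp
    ring
  let b := Basis.mk hli hsp
  have hq : Algebra.IsQuadraticExtension (maximalRealSubfield F) F :=
    { toFree := Module.Free.of_basis b
      finrank_eq_two' := by rw [finrank_eq_card_basis b, Fintype.card_fin] }
  exact { }

/-! ### Primitivity of CM types -/

namespace CMType

variable {K : Type*} [Field K] [NumberField K]

/-- The cardinality condition leaves no room for a conjugate pair inside `Φ`: the indicator of `ψ`
would sum to both `1` and `2`. -/
theorem conjugate_mem_iff (Φ : CMType K) (ψ : K →+* ℂ) :
    ComplexEmbedding.conjugate ψ ∈ Φ.embeddings ↔ ψ ∉ Φ.embeddings := by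
  classical
  refine ⟨fun h h' => ?_, fun h => (Φ.mem_or_conj_mem ψ).resolve_left h⟩
  have hinv : ∀ χ : K →+* ℂ,
      ComplexEmbedding.conjugate (ComplexEmbedding.conjugate χ) = χ := star_star
  have key := Φ.sum_embeddings (fun χ => if χ = ψ then 1 else 0)
  rw [Finset.sum_add_distrib] at key
  have h1 : ∑ φ : Φ.embeddings, (if (φ : K →+* ℂ) = ψ then (1 : ℂ) else 0) = 1 := by
    rw [Finset.sum_eq_single ⟨ψ, h'⟩] <;> simp +contextual [Subtype.ext_iff]
  have h2 : ∑ φ : Φ.embeddings,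
      (if ComplexEmbedding.conjugate (φ : K →+* ℂ) = ψ then (1 : ℂ) else 0) = 1 := by
    rw [Finset.sum_eq_single ⟨_, h⟩]
    · simp [hinv]
    · intro φ _ hφ
      refine if_neg fun hψ => hφ (Subtype.ext ?_)
      subst hψ
      exact (hinv _).symm
    · simp
  rw [h1, h2] at key
  simp at key

/-- Two embeddings that no automorphism of `ℂ` separates with respect to `Φ`. -/
def Inseparable (Φ : CMType K) (φ ψ : K →+* ℂ) : Prop :=
  ∀ S : ℂ ≃+* ℂ, (S : ℂ →+* ℂ).comp φ ∈ Φ.embeddings ↔ (S : ℂ →+* ℂ).comp ψ ∈ Φ.embeddings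

theorem Inseparable.comp {Φ : CMType K} {φ ψ : K →+* ℂ} (h : Φ.Inseparable φ ψ) (S : ℂ ≃+* ℂ) :
    Φ.Inseparable ((S : ℂ →+* ℂ).comp φ) ((S : ℂ →+* ℂ).comp ψ) :=
  fun R => h (S.trans R)

/-- If a CM field has no strict CM subfield, then each of its CM types is primitive. -/
theorem Inseparable.eq [IsCMField K] (hK : ∀ F : Subfield K, IsCMField F → F = ⊤)
    {Φ : CMType K} {ψ₁ ψ₂ : K →+* ℂ} (h : Φ.Inseparable ψ₁ ψ₂) : ψ₁ = ψ₂ := by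
  classical
  let F : Subfield K := ⨅ ψ : {ψ : K →+* ℂ // Φ.Inseparable ψ₁ ψ}, RingHom.eqLocusField ψ₁ ψ.1
  have hmem : ∀ x, x ∈ F ↔ ∀ ψ, Φ.Inseparable ψ₁ ψ → ψ₁ x = ψ x := by
    intro x
    simp only [F, Subfield.mem_iInf, Subtype.forall]
    rfl
  suffices hF : F = ⊤ by
    ext x
    exact (hmem x).mp (hF ▸ Subfield.mem_top x) ψ₂ h
  have hstab : ∀ x ∈ F, IsCMField.complexConj K x ∈ F := by
    intro x hx
    rw [hmem] at hx ⊢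
    intro ψ hψ
    rw [IsCMField.complexEmbedding_complexConj, IsCMField.complexEmbedding_complexConj, hx ψ hψ]
  by_contra hne
  have hfix : ∀ x ∈ F, IsCMField.complexConj K x = x := by
    intro x hx
    by_contra hx'
    exact hne (hK F (.of_complexConj_mem F hstab hx hx'))
  -- An automorphism of `ℂ` sending `ψ₁` into its class `C` permutes `C`, hence fixes every sum over
  -- `C`.
  let C : Finset (K →+* ℂ) := Finset.univ.filter (Φ.Inseparable ψ₁)
  have hC : ∀ ψ, ψ ∈ C ↔ Φ.Inseparable ψ₁ ψ := fun ψ => by simp [C]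
  have hsum : ∀ (S : ℂ ≃+* ℂ), Φ.Inseparable ψ₁ ((S : ℂ →+* ℂ).comp ψ₁) → ∀ x,
      S (∑ ψ ∈ C, ψ x) = ∑ ψ ∈ C, ψ x := by
    intro S hS x
    rw [map_sum]
    have hback : ∀ ψ : K →+* ℂ,
        (S : ℂ →+* ℂ).comp ((S.symm : ℂ →+* ℂ).comp ψ) = ψ := fun ψ => by ext; simp
    have hforth : ∀ ψ : K →+* ℂ,
        (S.symm : ℂ →+* ℂ).comp ((S : ℂ →+* ℂ).comp ψ) = ψ := fun ψ => by ext; simp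
    refine Finset.sum_nbij' (fun ψ => (S : ℂ →+* ℂ).comp ψ) (fun ψ => (S.symm : ℂ →+* ℂ).comp ψ)
      (fun ψ hψ => ?_) (fun ψ hψ => ?_) (fun ψ _ => hforth ψ) (fun ψ _ => hback ψ)
      (fun ψ _ => rfl)
    · rw [hC] at hψ ⊢
      exact fun R => (hS R).trans (hψ.comp S R)
    · rw [hC] at hψ ⊢
      have h1 := hS.comp S.symm
      rw [hforth] at h1
      exact fun R => (h1 R).symm.trans (hψ.comp S.symm R)
  have hreal : ∀ x, conj (∑ ψ ∈ C, ψ x) = ∑ ψ ∈ C, ψ x := by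
    intro x
    let := ψ₁.toAlgebra
    have halg : IsAlgebraic K (∑ ψ ∈ C, ψ x) := by
      refine IsIntegral.isAlgebraic (IsIntegral.sum _ fun ψ _ => ?_)
      have : IsIntegral ℚ (ψ x) := (Algebra.IsIntegral.isIntegral x).map ψ.toRatAlgHom
      have hst : IsScalarTower ℚ K ℂ := .of_algebraMap_eq fun q => (map_ratCast ψ₁ q).symm
      exact this.tower_top
    -- Automorphisms fixing `ψ₁(K)` fix the sum, so it equals `ψ₁ a`; those moving `ψ₁` within `C`
    -- then put `a` in `F`, where conjugation is trivial.
    obtain ⟨a, ha⟩ := IsAlgClosed.mem_range_algebraMap_of_forall_fixed halg fun S hS => by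
      refine hsum S ?_ x
      have : (S : ℂ →+* ℂ).comp ψ₁ = ψ₁ := RingHom.ext hS
      rw [this]
      exact fun _ => Iff.rfl
    change ψ₁ a = _ at ha
    have haF : a ∈ F := by
      rw [hmem]
      intro ψ hψ
      obtain ⟨S, hS⟩ := IsAlgClosed.exists_ringEquiv_comp_eq ψ₁.toRatAlgHom ψ.toRatAlgHom
      have hS' : (S : ℂ →+* ℂ).comp ψ₁ = ψ := RingHom.ext hS
      have h1 := hsum S (hS'.symm ▸ hψ) x
      rw [← ha] at h1
      rw [← h1]
      exact hS a
    rw [← ha, ← IsCMField.complexEmbedding_complexConj, hfix a haF]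
  -- Since the sums are real, linear independence identifies `C` with its conjugate.
  have hind : (fun ψ => if ψ ∈ C then (1 : ℂ) else 0) =
      fun ψ => if ComplexEmbedding.conjugate ψ ∈ C then (1 : ℂ) else 0 := by
    refine RingHom.eq_of_sum_mul_eq fun x => ?_
    have hinv : Function.Involutive (ComplexEmbedding.conjugate (K := K)) := star_star
    rw [← Equiv.sum_comp hinv.toPerm
      fun ψ => (if ComplexEmbedding.conjugate ψ ∈ C then (1 : ℂ) else 0) * ψ x]
    simp only [Function.Involutive.coe_toPerm, hinv _, ite_mul, one_mul, zero_mul,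
      Finset.sum_ite_mem, Finset.univ_inter]
    rw [← hreal, map_sum]
    rfl
  have h1 := congrFun hind ψ₁
  have hψ₁ : ψ₁ ∈ C := (hC _).mpr fun _ => Iff.rfl
  have h2 : ComplexEmbedding.conjugate ψ₁ ∈ C := by
    by_contra h2
    simp [hψ₁, h2] at h1
  have h3 := (hC _).mp h2 (RingEquiv.refl ℂ)
  have h4 : ∀ ψ : K →+* ℂ, ((RingEquiv.refl ℂ : ℂ ≃+* ℂ) : ℂ →+* ℂ).comp ψ = ψ := fun _ => rfl
  rw [h4, h4, Φ.conjugate_mem_iff] at h3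
  exact iff_not_self h3

end CMType

/-! ## Isomorphisms of the abelian varieties attached to triples -/

namespace CMType

variable {K : Type*} [Field K] [NumberField K]

theorem mem_comp_embeddings (Φ : CMType K) (σ : K ≃+* K) (ψ : K →+* ℂ) :
    ψ ∈ (Φ.comp σ).embeddings ↔ ψ.comp (σ.symm : K →+* K) ∈ Φ.embeddings := by
  simp only [comp, Finset.mem_map]
  constructor
  · rintro ⟨φ, hφ, rfl⟩
    have : (φ.comp (σ : K →+* K)).comp (σ.symm : K →+* K) = φ := by ext x; simp
    exact this.symm ▸ hφ
  · intro h
    exact ⟨_, h, by ext x; exact congrArg ψ (σ.symm_apply_apply x)⟩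

theorem toPi_injective (Φ : CMType K) : Function.Injective Φ.toPi := by
  have : Nonempty Φ.embeddings := by
    rw [Finset.nonempty_coe_sort, ← Finset.card_pos]
    have := Φ.two_mul_card
    have := finrank_pos (R := ℚ) (M := K)
    omega
  intro x y h
  obtain ⟨φ⟩ := this
  exact (φ : K →+* ℂ).injective (congrFun h φ)

/-- A `ℂ`-linear map compatible with a map `h : K → K` expresses each embedding composed with `h`
as a combination of embeddings lying on the same side of the CM types. -/
theorem exists_coeff_of_linearMap (Φ Φ' : CMType K)
    (f : (Φ.embeddings → ℂ) →ₗ[ℂ] (Φ'.embeddings → ℂ)) (h : K → K)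
    (hf : ∀ x, f (Φ.toPi x) = Φ'.toPi (h x)) (ψ' : K →+* ℂ) :
    ∃ t : (K →+* ℂ) → ℂ, (∀ x, ψ' (h x) = ∑ ψ, t ψ * ψ x) ∧
      ∀ ψ, t ψ ≠ 0 → (ψ ∈ Φ.embeddings ↔ ψ' ∈ Φ'.embeddings) := by
  classical
  have main : ∀ ψ' ∈ Φ'.embeddings, ∃ t : (K →+* ℂ) → ℂ, (∀ x, ψ' (h x) = ∑ ψ, t ψ * ψ x) ∧
      ∀ ψ, t ψ ≠ 0 → ψ ∈ Φ.embeddings := by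
    intro ψ' hψ'
    -- The coefficients are the matrix entries of `f` in row `ψ'`, extended by zero outside `Φ`.
    refine ⟨fun ψ => if hψ : ψ ∈ Φ.embeddings then f (Pi.single ⟨ψ, hψ⟩ 1) ⟨ψ', hψ'⟩ else 0,
      fun x => ?_, fun ψ hψ => ?_⟩
    · have h1 := congrFun (hf x) ⟨ψ', hψ'⟩
      rw [CMType.toPi_apply] at h1
      rw [← h1, LinearMap.pi_apply_eq_sum_univ f, Finset.sum_apply,
        ← Finset.sum_subset (Finset.subset_univ Φ.embeddings), ← Finset.sum_coe_sort Φ.embeddings]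
      · refine Finset.sum_congr rfl fun φ _ => ?_
        simp only [φ.2, dite_true, Subtype.coe_eta]
        rw [Pi.smul_apply, smul_eq_mul, mul_comm]
        congr 1
        refine congrArg (fun w => f w ⟨ψ', hψ'⟩) (funext fun j => ?_)
        simp [Pi.single_apply, eq_comm]
      · intro ψ _ hψ
        simp only [hψ, dite_false, zero_mul]
    · by_contra hn
      exact hψ (dif_neg hn)
  by_cases hψ' : ψ' ∈ Φ'.embeddings
  · obtain ⟨t, ht, ht'⟩ := main ψ' hψ'
    exact ⟨t, ht, fun ψ hψ => iff_of_true (ht' ψ hψ) hψ'⟩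
  -- For `ψ'` outside `Φ'`, conjugate the expansion of its conjugate; conjugation exchanges `Φ` with
  -- its complement.
  · obtain ⟨t, ht, ht'⟩ := main _ ((Φ'.conjugate_mem_iff ψ').mpr hψ')
    have hinv : Function.Involutive (ComplexEmbedding.conjugate (K := K)) := star_star
    refine ⟨fun ψ => conj (t (ComplexEmbedding.conjugate ψ)), fun x => ?_, fun ψ hψ => ?_⟩
    · have h1 := congrArg conj (ht x)
      rw [ComplexEmbedding.conjugate_coe_eq, Complex.conj_conj] at h1
      rw [h1, map_sum, ← Equiv.sum_comp hinv.toPerm]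
      refine Finset.sum_congr rfl fun ψ _ => ?_
      simp
    · refine iff_of_false ?_ hψ'
      rw [← Φ.conjugate_mem_iff]
      exact ht' _ (by simpa using hψ)

/-- If `K` has no strict CM subfield, then a `ℂ`-linear isomorphism compatible with `h : K → K`
is, up to a scalar, given by an automorphism of `K`. -/
theorem exists_ringEquiv_of_linearEquiv [IsCMField K]
    (hK : ∀ F : Subfield K, IsCMField F → F = ⊤) (Φ Φ' : CMType K)
    (f : (Φ.embeddings → ℂ) ≃ₗ[ℂ] (Φ'.embeddings → ℂ)) (h : K → K)
    (hf : ∀ x, f (Φ.toPi x) = Φ'.toPi (h x)) :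
    ∃ (σ : K ≃+* K) (γ : Kˣ), Φ' = Φ.comp σ ∧ ∀ x, σ (h x) = γ * x := by
  classical
  choose t ht hΦ using Φ.exists_coeff_of_linearMap Φ' f.toLinearMap h hf
  have hinj : Function.Injective h := fun x y hxy => by
    apply Φ.toPi_injective
    apply f.injective
    rw [hf, hf, hxy]
  have hzero : h 0 = 0 := by
    apply Φ'.toPi_injective
    rw [← hf, map_zero, map_zero, map_zero]
  have h1 : h 1 ≠ 0 := fun h' => one_ne_zero (hinj (h'.trans hzero.symm))
  have hequiv : ∀ (S : ℂ ≃+* ℂ) (ψ' ψ : K →+* ℂ),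
      t ((S : ℂ →+* ℂ).comp ψ') ((S : ℂ →+* ℂ).comp ψ) = S (t ψ' ψ) := by
    intro S ψ'
    let e : (K →+* ℂ) ≃ (K →+* ℂ) :=
      { toFun := fun ψ => (S : ℂ →+* ℂ).comp ψ
        invFun := fun ψ => (S.symm : ℂ →+* ℂ).comp ψ
        left_inv := fun ψ => by ext x; simp
        right_inv := fun ψ => by ext x; simp }
    -- Applying `S` to the expansion of `ψ' ∘ h` gives an expansion of `(S ∘ ψ') ∘ h`, and
    -- coefficients are unique.
    have key : t (e ψ') = fun ψ => S (t ψ' (e.symm ψ)) := by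
      refine RingHom.eq_of_sum_mul_eq fun x => ?_
      rw [← ht, ← Equiv.sum_comp e]
      change S (ψ' (h x)) = _
      rw [ht, map_sum]
      refine Finset.sum_congr rfl fun ψ _ => ?_
      rw [map_mul, e.symm_apply_apply]
      rfl
    intro ψ
    have := congrFun key (e ψ)
    rw [e.symm_apply_apply] at this
    exact this
  have huniq : ∀ ψ' ψ₁ ψ₂, t ψ' ψ₁ ≠ 0 → t ψ' ψ₂ ≠ 0 → ψ₁ = ψ₂ := by
    intro ψ' ψ₁ ψ₂ h₁ h₂
    -- For every `S`, whether `S ∘ ψ₁` and `S ∘ ψ₂` lie in `Φ` is decided by whether `S ∘ ψ'` lies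
    -- in `Φ'`.
    refine CMType.Inseparable.eq hK (Φ := Φ) fun S => ?_
    rw [hΦ ((S : ℂ →+* ℂ).comp ψ') _ (by simpa [hequiv] using h₁),
      hΦ ((S : ℂ →+* ℂ).comp ψ') _ (by simpa [hequiv] using h₂)]
  have hex : ∀ ψ' : K →+* ℂ, ∃ ψ : K →+* ℂ, (ψ ∈ Φ.embeddings ↔ ψ' ∈ Φ'.embeddings) ∧
      ∀ x, ψ' (h x / h 1) = ψ x := by
    intro ψ'
    have h1' : ψ' (h 1) ≠ 0 := (map_ne_zero ψ').mpr h1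
    obtain ⟨ψ, -, hψ⟩ : ∃ ψ ∈ Finset.univ, t ψ' ψ * ψ 1 ≠ 0 :=
      Finset.exists_ne_zero_of_sum_ne_zero (by rw [← ht]; exact h1')
    have hψ0 : t ψ' ψ ≠ 0 := left_ne_zero_of_mul hψ
    have hx : ∀ x, ψ' (h x) = t ψ' ψ * ψ x := by
      intro x
      rw [ht, Finset.sum_eq_single ψ (fun χ _ hχ => ?_) (by simp)]
      have : t ψ' χ = 0 := by
        by_contra h0
        exact hχ (huniq ψ' χ ψ h0 hψ0)
      rw [this, zero_mul]
    refine ⟨ψ, hΦ ψ' ψ hψ0, fun x => ?_⟩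
    rw [map_div₀, hx, hx, map_one, mul_one, mul_div_cancel_left₀ _ hψ0]
  obtain ⟨ψ₀⟩ : Nonempty (K →+* ℂ) := inferInstance
  obtain ⟨χ, -, hχ⟩ := hex ψ₀
  -- No additivity of `h` is assumed: both ring laws are pulled back from `χ` through the injective
  -- `ψ₀`.
  let τ : K →+* K :=
    { toFun := fun x => h x / h 1
      map_one' := div_self h1
      map_mul' := fun x y => ψ₀.injective (by rw [map_mul, hχ, hχ, hχ, map_mul])
      map_zero' := by rw [hzero, zero_div]
      map_add' := fun x y => ψ₀.injective (by rw [map_add, hχ, hχ, hχ, map_add]) }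
  let e : K ≃+* K := RingEquiv.ofBijective τ
    (Algebra.IsAlgebraic.algHom_bijective τ.toRatAlgHom)
  have he : ∀ x, e x = h x / h 1 := fun _ => rfl
  -- From `h x = h 1 * e x`, applying `σ = e⁻¹` gives `σ (h x) = σ (h 1) * x`, so `γ = σ (h 1)`.
  refine ⟨e.symm, Units.mk0 (e.symm (h 1)) (by simpa using h1), ?_, fun x => ?_⟩
  · ext ψ'
    rw [CMType.mem_comp_embeddings, e.symm_symm]
    obtain ⟨ψ, hψ, hψ'⟩ := hex ψ'
    have : ψ'.comp (e : K →+* K) = ψ := RingHom.ext hψ'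
    rw [this, hψ]
  · rw [Units.val_mk0]
    apply e.injective
    rw [map_mul, e.apply_symm_apply, e.apply_symm_apply, he, mul_div_cancel₀ _ h1]

end CMType

/-- Complex conjugation of a CM field commutes with automorphisms. -/
theorem NumberField.IsCMField.map_complexConj {K : Type*} [Field K] [NumberField K]
    [IsCMField K] (σ : K ≃+* K) (x : K) :
    σ (IsCMField.complexConj K x) = IsCMField.complexConj K (σ x) := by
  obtain ⟨φ⟩ : Nonempty (K →+* ℂ) := inferInstance
  apply φ.injective
  rw [IsCMField.complexEmbedding_complexConj]
  exact IsCMField.complexEmbedding_complexConj K (φ.comp (σ : K →+* K)) x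

/-! ### The two implications for triples -/

namespace CMTriple

variable {K : Type*} [Field K] [NumberField K] [IsCMField K]

/-- The isomorphism restricts to `α ↦ σ⁻¹(γ α)` on `K`; the factor `(γ γ̄)⁻¹` in `ξ'` cancels the
scaling of the form. -/
theorem isomorphic_of_twist (T T' : CMTriple K) (σ : K ≃+* K) (γ : Kˣ)
    (hΦ : T'.Φ = T.Φ.comp σ)
    (h𝔞 : fractionalIdealImage σ T'.𝔞 = FractionalIdeal.spanSingleton (𝓞 K)⁰ (γ : K) * T.𝔞)
    (hξ : σ T'.ξ = ((γ : K) * IsCMField.complexConj K (γ : K))⁻¹ * T.ξ) :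
    T.abelianVariety.Isomorphic T'.abelianVariety := by
  let e : T'.Φ.embeddings ≃ T.Φ.embeddings :=
    { toFun := fun φ => ⟨(φ : K →+* ℂ).comp (σ.symm : K →+* K),
        (T.Φ.mem_comp_embeddings σ φ).mp (hΦ ▸ φ.2)⟩
      invFun := fun φ => ⟨(φ : K →+* ℂ).comp (σ : K →+* K), by
        rw [hΦ, CMType.mem_comp_embeddings]
        convert! φ.2
        ext x; simp⟩
      left_inv := fun φ => by ext x; simp
      right_inv := fun φ => by ext x; simp }
  have he : ∀ (φ : T'.Φ.embeddings) x, (e φ : K →+* ℂ) x = (φ : K →+* ℂ) (σ.symm x) :=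
    fun _ _ => rfl
  let f : (T.Φ.embeddings → ℂ) ≃ₗ[ℂ] (T'.Φ.embeddings → ℂ) :=
    (LinearEquiv.piCongrRight fun φ : T.Φ.embeddings =>
      LinearEquiv.smulOfUnit (Units.map ((φ : K →+* ℂ) : K →* ℂ) γ)).trans
      (LinearEquiv.funCongrLeft ℂ ℂ e)
  have hf : ∀ u φ, f u φ = (e φ : K →+* ℂ) γ * u (e φ) := fun _ _ => rfl
  have hfΦ : ∀ α, f (T.Φ.toPi α) = T'.Φ.toPi (σ.symm (γ * α)) := by
    intro α
    funext φ
    rw [hf, CMType.toPi_apply, CMType.toPi_apply, ← map_mul, he]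
  refine ⟨f, Set.Subset.antisymm ?_ ?_, fun u v => ?_⟩
  · rintro _ ⟨_, ⟨α, hα, rfl⟩, rfl⟩
    refine ⟨σ.symm (γ * α), ?_, (hfΦ α).symm⟩
    have hmem : (γ : K) * α ∈ fractionalIdealImage σ T'.𝔞 := by
      rw [h𝔞, FractionalIdeal.mem_singleton_mul]
      exact ⟨α, hα, rfl⟩
    obtain ⟨β, hβ, h⟩ := hmem
    rw [← h, RingEquiv.symm_apply_apply]
    exact hβ
  · rintro _ ⟨β, hβ, rfl⟩
    have hmem : σ β ∈ fractionalIdealImage σ T'.𝔞 := ⟨β, hβ, rfl⟩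
    rw [h𝔞, FractionalIdeal.mem_singleton_mul] at hmem
    obtain ⟨α, hα, h⟩ := hmem
    refine ⟨_, ⟨α, hα, rfl⟩, (hfΦ α).trans ?_⟩
    rw [← h, RingEquiv.symm_apply_apply]
    rfl
  · change T'.Φ.form T'.ξ (f u) (f v) = T.Φ.form T.ξ u v
    rw [CMType.form_apply, CMType.form_apply, ← Equiv.sum_comp e]
    refine Finset.sum_congr rfl fun φ _ => ?_
    have hξφ : (φ : K →+* ℂ) T'.ξ = (e φ : K →+* ℂ) (σ T'.ξ) := by
      rw [he, RingEquiv.symm_apply_apply]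
    have hγ : (e φ : K →+* ℂ) γ ≠ 0 := by simp
    have hγ' : conj ((e φ : K →+* ℂ) γ) ≠ 0 := by simp
    rw [hf, hf, hξφ, hξ, map_mul, map_inv₀, map_mul, IsCMField.complexEmbedding_complexConj,
      map_mul]
    congr 2
    field_simp

theorem exists_twist_of_isomorphic (hK : ∀ F : Subfield K, IsCMField F → F = ⊤)
    (T T' : CMTriple K) (hiso : T.abelianVariety.Isomorphic T'.abelianVariety) :
    ∃ (σ : K ≃+* K) (γ : Kˣ), T'.Φ = T.Φ.comp σ ∧
      fractionalIdealImage σ T'.𝔞 = FractionalIdeal.spanSingleton (𝓞 K)⁰ (γ : K) * T.𝔞 ∧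
      σ T'.ξ = ((γ : K) * IsCMField.complexConj K (γ : K))⁻¹ * T.ξ := by
  obtain ⟨f, hΛ, hE⟩ := hiso
  have hΛ' : ∀ u, u ∈ T.Φ.lattice T.𝔞 ↔ f u ∈ T'.Φ.lattice T'.𝔞 := by
    intro u
    rw [← SetLike.mem_coe (p := T'.Φ.lattice T'.𝔞)]
    change _ ↔ f u ∈ (T'.abelianVariety.lattice : Set _)
    rw [← hΛ, f.injective.mem_set_image]
    rfl
  -- A `ℤ`-basis of `𝔞` spans `K` over `ℚ`, so the lattice condition propagates to all of `K`.
  have hex : ∀ x, ∃ y, f (T.Φ.toPi x) = T'.Φ.toPi y := by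
    intro x
    have hx := (basisOfFractionalIdeal K (Units.mk0 T.𝔞 T.ideal_ne_zero)).mem_span x
    induction hx using Submodule.span_induction with
    | mem x hx =>
      have hx' : x ∈ T.𝔞 := (mem_span_basisOfFractionalIdeal K
        (I := Units.mk0 T.𝔞 T.ideal_ne_zero)).mp (Submodule.subset_span hx)
      obtain ⟨y, -, hy⟩ := (hΛ' _).mp ⟨x, hx', rfl⟩
      exact ⟨y, hy.symm⟩
    | zero => exact ⟨0, by rw [map_zero, map_zero, map_zero]⟩
    | add x y _ _ hx hy =>
      obtain ⟨x', hx⟩ := hx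
      obtain ⟨y', hy⟩ := hy
      exact ⟨x' + y', by rw [map_add, map_add, map_add, hx, hy]⟩
    | smul q x _ hx =>
      obtain ⟨x', hx⟩ := hx
      have hq : ∀ (Φ : CMType K) (z : K), Φ.toPi (q • z) = (q : ℂ) • Φ.toPi z := fun Φ z => by
        funext φ
        simp [Rat.smul_def]
      exact ⟨q • x', by rw [hq, hq, map_smul, hx]⟩
  choose h hf using hex
  obtain ⟨σ, γ, hΦ, hσ⟩ := T.Φ.exists_ringEquiv_of_linearEquiv hK T'.Φ f h hf
  have hmem : ∀ x, x ∈ T.𝔞 ↔ h x ∈ T'.𝔞 := by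
    have hl : ∀ (Φ : CMType K) (𝔟 : FractionalIdeal (𝓞 K)⁰ K) x,
        Φ.toPi x ∈ Φ.lattice 𝔟 ↔ x ∈ 𝔟 := fun Φ 𝔟 x => by
      rw [CMType.mem_lattice]
      exact ⟨fun ⟨y, hy, hyx⟩ => Φ.toPi_injective hyx ▸ hy, fun hx => ⟨x, hx, rfl⟩⟩
    intro x
    rw [← hl T.Φ, ← hl T'.Φ, hΛ', hf]
  refine ⟨σ, γ, hΦ, ?_, ?_⟩
  · ext x
    rw [mem_fractionalIdealImage, FractionalIdeal.mem_singleton_mul]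
    constructor
    · rintro ⟨y, hy, rfl⟩
      have hy' : h ((γ : K)⁻¹ * σ y) = y := σ.injective (by rw [hσ]; simp)
      refine ⟨(γ : K)⁻¹ * σ y, ?_, by simp⟩
      rw [hmem, hy']
      exact hy
    · rintro ⟨y, hy, rfl⟩
      exact ⟨h y, (hmem y).mp hy, hσ y⟩
  · have htr : ∀ α, Algebra.trace ℚ K (σ T'.ξ * (γ * IsCMField.complexConj K γ) * α) =
        Algebra.trace ℚ K (T.ξ * α) := by
      intro α
      -- Comparing the forms against `1` is enough: the trace is `σ`-invariant, `σ` commutes with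
      -- conjugation, and the trace form is nondegenerate.
      have h1 := hE (T.Φ.toPi α) (T.Φ.toPi 1)
      change T'.Φ.form T'.ξ _ _ = T.Φ.form T.ξ _ _ at h1
      rw [hf, hf, CMType.form_toPi, CMType.form_toPi, Rat.cast_inj] at h1
      rw [map_one, mul_one, ← Algebra.trace_eq_of_algEquiv
        (AlgEquiv.ofRingEquiv (f := σ) (fun q => map_ratCast σ q))] at h1
      rw [← h1]
      congr 1
      change _ = σ _
      rw [map_mul, map_mul, hσ, IsCMField.map_complexConj, hσ, mul_one]
      ring
    have hγ : (γ : K) ≠ 0 := γ.ne_zero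
    have hγ' : IsCMField.complexConj K (γ : K) ≠ 0 := by simp
    have key : σ T'.ξ * (γ * IsCMField.complexConj K γ) = T.ξ := by
      refine sub_eq_zero.mp ((traceForm_nondegenerate ℚ K).1 _ fun α => ?_)
      rw [Algebra.traceForm_apply, sub_mul, map_sub, htr, sub_self]
    rw [← key]
    field_simp

end CMTriple

theorem mainTheorem7 (K : Type*) [Field K] [NumberField K] [IsCMField K]
    (hK : ∀ F : Subfield K, IsCMField F → F = ⊤) (T T' : CMTriple K) :
    T.abelianVariety.Isomorphic T'.abelianVariety ↔
      ∃ (σ : K ≃+* K) (γ : Kˣ),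
        T'.Φ = T.Φ.comp σ ∧
        fractionalIdealImage σ T'.𝔞 = FractionalIdeal.spanSingleton (𝓞 K)⁰ (γ : K) * T.𝔞 ∧
        σ T'.ξ = ((γ : K) * IsCMField.complexConj K (γ : K))⁻¹ * T.ξ :=
  ⟨CMTriple.exists_twist_of_isomorphic hK T T', fun ⟨σ, γ, hΦ, h𝔞, hξ⟩ =>
    CMTriple.isomorphic_of_twist T T' σ γ hΦ h𝔞 hξ⟩
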